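/- **Setting.** A dagger theory $\mathcal C$ is a dagger symmetric monoidal category (a symmetric monoidal category with an involutive identity-on-objects functor $(-)^\dagger\colon\mathcal C^{op}\to\mathcal C$ such that $(f\otimes g)^\dagger=f^\dagger\otimes g^\dagger$ and the coherence isomorphisms are unitary) with a chosen effect $d_A\colon A\to I$ ("discarding") on each object such that $d_I=\mathrm{id}_I$ and $d_{A\otimes B}=d_A\otimes d_B$ (up to $I\otimes I\cong I$), and with zero morphisms satisfying $0\otimes f=0$. States are morphisms $I\to A$, effects are morphisms $A\to I$. An isometry satisfies $f^\dagger f=\mathrm{id}$, a unitary also $ff^\dagger=\mathrm{id}$. A morphism $f\colon A\to B$ is causal if $d_B\circ f=d_A$. An object $A$ is trivial if $d_A$ is unitary or $A$ is a zero object; $\mathcal C$ is non-trivial if some object is not trivial. $\mathcal C$ is compact if every object $A$ has a dual $A^*$ with a state $\eta\colon I\to A^*\otimes A$ satisfying the snake equations with cap $\eta^\dagger\circ\sigma_{A,A^*}$ ($\sigma$ the symmetry), and $(\mathrm{id}_{A^*}\otimes d_A)\circ\eta=d_{A^*}^\dagger$. A dilation of $f\colon A\to B$ is a morphism $g\colon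 A\to B\otimes E$ with $(\mathrm{id}_B\otimes d_E)\circ g=f$. A morphism $f$ is pure if $f=0$ or every dilation of $f$ has the form $f\otimes\rho$ with $\rho$ a causal state. A dagger kernel of $f\colon A\to B$ is an isometry $k\colon K\to A$ with $f\circ k=0$ through which every $g$ with $f\circ g=0$ factors; dagger cokernels are defined dually (their daggers are isometries), and the complement of a dagger kernel $k\colon K\to A$ is $k^\perp:=\mathrm{coker}(k)^\dagger\colon K^\perp\to A$. The principles are: * *Strong purification*: (a) the pure morphisms form a dagger compact subcategory (on all objects); every morphism has a pure dilation; and all pure $f\colon A\to B$, $g\colon A\to D$ satisfy $d_B\circ f=d_D\circ g\iff f^\dagger f=g^\dagger g$. (b) Every non-zero object has a causal pure state. (c) If $f,g\colon A\to B\otimes E$ are pure and $(\mathrm{id}_B\otimes d_E)\circ f=(\mathrm{id}_B\otimes d_E)\circ g$, then $g=(\mathrm{id}_B\otimes U)\circ f$ for some pure unitary $U\colon E\to E$. * *Dagger kernels*: every morphism has a dagger kernel. * *Causal complementation*: for every dagger kernel $k\colon K\to A$ and all $f,g\colon B\to A$, if $d_K k^\dagger f=d_K k^\dagger g$ and $d_{K^\perp}(k^{\perp})^\dagger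 f=d_{K^\perp}(k^{\perp})^\dagger g$, then $d_A f=d_A g$. * *Pure exclusion*: for every causal pure state $\psi$ of a non-trivial object there is a non-zero effect $e$ with $e\circ\psi=0$. * *Conditioning*: for all states $|0\rangle,|1\rangle$ of an object $A$ that are isometries with $|1\rangle^\dagger\circ|0\rangle=0$, and all states $\rho,\sigma$ of an object $B$, there is $f\colon A\to B$ with $f\circ|0\rangle=\rho$ and $f\circ|1\rangle=\sigma$. A coarse-graining operation on $\mathcal C$ is an associative commutative operation $+$ on each homset with $f+0=f$, $f\circ(g+h)=f\circ g+f\circ h$, $f\otimes(g+h)=f\otimes g+f\otimes h$ and $(f+g)^\dagger=f^\dagger+g^\dagger$. **Proposition.** Let $\mathcal C$ be a dagger theory with dagger kernels. 1. Suppose that $\mathcal C$ is non-trivial and compact and satisfies strong purification, causal complementation and pure exclusion. Then $\mathcal C$ satisfies conditioning if and only if it has a coarse-graining operation, and $\mathcal C$ has at most one coarse-graining operation. 2. Let $+$ be a coarse-graining operation on $\mathcal C$, and consider the equation $$d_K\circ k^\dagger+d_{K^\perp}\circ (k^\perp)^\dagger=d_A\qquad(\ast)$$ for a dagger kernel $k\colon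 K\to A$. If $\mathcal C$ is compact and satisfies strong purification, then causal complementation holds if and only if all dagger kernels are causal and satisfy $(\ast)$. For $\mathcal C$ an arbitrary dagger theory with dagger kernels and coarse-graining, all dagger kernels are causal and causal complementation holds if and only if all dagger kernels are causal and satisfy $(\ast)$. -/

import Mathlib

open CategoryTheory MonoidalCategory CategoryTheory.Limits

universe v u

/-- A dagger symmetric monoidal category: an involutive, identity-on-objects contravariant functor
that is compatible with the tensor product and for which the coherence isomorphisms are unitary. -/
class DaggerSymmetricCategory (C : Type u) [Category.{v} C] [MonoidalCategory C]
    [SymmetricCategory C] where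
  dag : ∀ {A B : C}, (A ⟶ B) → (B ⟶ A)
  dag_id : ∀ A : C, dag (𝟙 A) = 𝟙 A
  dag_comp : ∀ {A B D : C} (f : A ⟶ B) (g : B ⟶ D), dag (f ≫ g) = dag g ≫ dag f
  dag_dag : ∀ {A B : C} (f : A ⟶ B), dag (dag f) = f
  dag_tensor : ∀ {A B A' B' : C} (f : A ⟶ B) (g : A' ⟶ B'), dag (f ⊗ₘ g) = dag f ⊗ₘ dag g
  dag_associator : ∀ A B D : C, dag (α_ A B D).hom = (α_ A B D).inv
  dag_leftUnitor : ∀ A : C, dag (λ_ A).hom = (λ_ A).inv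
  dag_rightUnitor : ∀ A : C, dag (ρ_ A).hom = (ρ_ A).inv
  dag_braiding : ∀ A B : C, dag (β_ A B).hom = (β_ A B).inv

/-- A dagger theory with zero morphisms: a dagger symmetric monoidal category with a discarding
effect on each object and with zero morphisms compatible with the tensor product. -/
class DaggerTheory (C : Type u) [Category.{v} C] [MonoidalCategory C] [SymmetricCategory C]
    [HasZeroMorphisms C] extends DaggerSymmetricCategory C where
  discard : ∀ A : C, A ⟶ 𝟙_ C
  discard_unit : discard (𝟙_ C) = 𝟙 (𝟙_ C)
  discard_tensor : ∀ A B : C,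
    discard (A ⊗ B) = (discard A ⊗ₘ discard B) ≫ (λ_ (𝟙_ C)).hom
  zero_tensor : ∀ {A B A' B' : C} (f : A' ⟶ B'), (0 : A ⟶ B) ⊗ₘ f = 0

namespace DaggerTheory

open DaggerSymmetricCategory

section Dagger

variable {C : Type u} [Category.{v} C] [MonoidalCategory C] [SymmetricCategory C]
  [DaggerSymmetricCategory C]

/-- `f† ∘ f = id`. -/
def IsIsometry {A B : C} (f : A ⟶ B) : Prop := f ≫ dag f = 𝟙 A

/-- `f† ∘ f = id` and `f ∘ f† = id`. -/
def IsUnitary {A B : C} (f : A ⟶ B) : Prop := f ≫ dag f = 𝟙 A ∧ dag f ≫ f = 𝟙 B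

/-- The object `A'` with the state `cup` of `A' ⊗ A` is a dagger dual of `A`: the snake equations
hold, where the cap on `A ⊗ A'` is the swap followed by the dagger of the cup. -/
structure IsDaggerDual (A A' : C) (cup : 𝟙_ C ⟶ A' ⊗ A) : Prop where
  snake_left : A ◁ cup ≫ (α_ A A' A).inv ≫ ((β_ A A').hom ≫ dag cup) ▷ A =
    (ρ_ A).hom ≫ (λ_ A).inv
  snake_right : cup ▷ A' ≫ (α_ A' A A').hom ≫ A' ◁ ((β_ A A').hom ≫ dag cup) =
    (λ_ A').hom ≫ (ρ_ A').inv

/-- A dagger compact subcategory on all objects: a class of morphisms that contains the identities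
and the structural isomorphisms, is closed under composition, tensor and dagger, and contains a cup
for every object. -/
structure IsDaggerCompactSubcategory (P : MorphismProperty C) : Prop where
  id_mem : ∀ A : C, P (𝟙 A)
  comp_mem : ∀ {A B D : C} (f : A ⟶ B) (g : B ⟶ D), P f → P g → P (f ≫ g)
  tensor_mem : ∀ {A B A' B' : C} (f : A ⟶ B) (g : A' ⟶ B'), P f → P g → P (f ⊗ₘ g)
  dag_mem : ∀ {A B : C} (f : A ⟶ B), P f → P (dag f)
  associator_mem : ∀ A B D : C, P (α_ A B D).hom
  leftUnitor_mem : ∀ A : C, P (λ_ A).hom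
  rightUnitor_mem : ∀ A : C, P (ρ_ A).hom
  braiding_mem : ∀ A B : C, P (β_ A B).hom
  cup_mem : ∀ A : C, ∃ (A' : C) (cup : 𝟙_ C ⟶ A' ⊗ A), IsDaggerDual A A' cup ∧ P cup

variable [HasZeroMorphisms C]

/-- Two states are orthonormal when they are isometries with `k1† ∘ k0 = 0`. -/
def Orthonormal {A : C} (k0 k1 : 𝟙_ C ⟶ A) : Prop :=
  IsIsometry k0 ∧ IsIsometry k1 ∧ k0 ≫ dag k1 = 0

/-- `k` is a dagger kernel of `f`. -/
structure IsDaggerKernel {K A B : C} (k : K ⟶ A) (f : A ⟶ B) : Prop where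
  isometry : IsIsometry k
  zero : k ≫ f = 0
  factor : ∀ (D : C) (g : D ⟶ A), g ≫ f = 0 → ∃ h : D ⟶ K, g = h ≫ k

/-- `c` is a dagger cokernel of `f`. -/
structure IsDaggerCokernel {A B Q : C} (c : B ⟶ Q) (f : A ⟶ B) : Prop where
  isometry : IsIsometry (dag c)
  zero : f ≫ c = 0
  factor : ∀ (D : C) (g : B ⟶ D), f ≫ g = 0 → ∃ h : Q ⟶ D, g = c ≫ h

/-- `k` is a dagger kernel of some morphism. -/
def IsKernel {K A : C} (k : K ⟶ A) : Prop := ∃ (B : C) (f : A ⟶ B), IsDaggerKernel k f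

/-- `l` is a complement of `k`, that is, `l = coker(k)†`. -/
def IsComplement {K L A : C} (k : K ⟶ A) (l : L ⟶ A) : Prop := IsDaggerCokernel (dag l) k

variable (C)

/-- Every morphism has a dagger kernel. -/
def HasDaggerKernels : Prop :=
  ∀ (A B : C) (f : A ⟶ B), ∃ (K : C) (k : K ⟶ A), IsDaggerKernel k f

/-- For orthonormal states `k0`, `k1` and any states `s`, `t` there is a morphism sending
`k0` to `s` and `k1` to `t`. -/
def Conditioning : Prop :=
  ∀ (A : C) (k0 k1 : 𝟙_ C ⟶ A), Orthonormal k0 k1 →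
    ∀ (B : C) (s t : 𝟙_ C ⟶ B), ∃ f : A ⟶ B, k0 ≫ f = s ∧ k1 ≫ f = t

/-- A coarse-graining operation: dagger monoidal enrichment in commutative monoids, with the zero
morphisms as units. -/
@[ext]
structure CoarseGraining where
  add : ∀ {A B : C}, (A ⟶ B) → (A ⟶ B) → (A ⟶ B)
  add_assoc : ∀ {A B : C} (f g h : A ⟶ B), add (add f g) h = add f (add g h)
  add_comm : ∀ {A B : C} (f g : A ⟶ B), add f g = add g f
  add_zero : ∀ {A B : C} (f : A ⟶ B), add f 0 = f
  add_comp : ∀ {A B D : C} (g h : A ⟶ B) (f : B ⟶ D), add g h ≫ f = add (g ≫ f) (h ≫ f)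
  tensor_add : ∀ {A B A' B' : C} (f : A ⟶ B) (g h : A' ⟶ B'),
    f ⊗ₘ add g h = add (f ⊗ₘ g) (f ⊗ₘ h)
  dag_add : ∀ {A B : C} (f g : A ⟶ B), dag (add f g) = add (dag f) (dag g)

end Dagger

variable {C : Type u} [Category.{v} C] [MonoidalCategory C] [SymmetricCategory C]
  [HasZeroMorphisms C] [DaggerTheory C]

/-- `f` preserves discarding. -/
def IsCausal {A B : C} (f : A ⟶ B) : Prop := f ≫ discard B = discard A

/-- `g` is a dilation of `f`: discarding the extra output `E` of `g` gives `f`. -/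
def IsDilation {A B E : C} (g : A ⟶ B ⊗ E) (f : A ⟶ B) : Prop :=
  g ≫ B ◁ discard E ≫ (ρ_ B).hom = f

/-- The pure morphisms: `f = 0`, or every dilation of `f` is `f ⊗ r` for some causal state `r`. -/
def pureMorphisms : MorphismProperty C := fun A B f =>
  f = 0 ∨ ∀ (E : C) (g : A ⟶ B ⊗ E), IsDilation g f →
    ∃ r : 𝟙_ C ⟶ E, IsCausal r ∧ g = (ρ_ A).inv ≫ (f ⊗ₘ r)

/-- An object is trivial when its discarding effect is unitary or it is a zero object. -/
def IsTrivialObj (A : C) : Prop := IsUnitary (discard A) ∨ IsZero A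

/-- The pair of effects `d`, `e` is total. -/
def IsTotalPair {A : C} (d e : A ⟶ 𝟙_ C) : Prop :=
  ∀ (B : C) (f g : B ⟶ A), f ≫ d = g ≫ d → f ≫ e = g ≫ e → f ≫ discard A = g ≫ discard A

/-- A dagger compact subcategory that contains a dilation of every morphism and satisfies the
CP axiom. -/
structure IsEnvironmentStructure (P : MorphismProperty C) : Prop
    extends IsDaggerCompactSubcategory P where
  dilation : ∀ {A B : C} (f : A ⟶ B), ∃ (E : C) (g : A ⟶ B ⊗ E), P g ∧ IsDilation g f
  cp : ∀ {A B D : C} (f : A ⟶ B) (g : A ⟶ D), P f → P g →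
    (f ≫ discard B = g ≫ discard D ↔ f ≫ dag f = g ≫ dag g)

variable (C)

/-- Some object is not trivial. -/
def NontrivialTheory : Prop := ∃ A : C, ¬ IsTrivialObj A

/-- The theory is compact: every object has a dagger dual, such that discarding the `A` half of the
cup gives the dagger of discarding on the dual. -/
def CompactTheory : Prop :=
  ∀ A : C, ∃ (A' : C) (cup : 𝟙_ C ⟶ A' ⊗ A), IsDaggerDual A A' cup ∧
    cup ≫ A' ◁ discard A ≫ (ρ_ A').hom = dag (discard A')

/-- Strong purification. -/
structure StrongPurification : Prop where
  environment : IsEnvironmentStructure (pureMorphisms : MorphismProperty C)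
  state : ∀ A : C, ¬ IsZero A → ∃ s : 𝟙_ C ⟶ A, pureMorphisms s ∧ IsCausal s
  essentially_unique : ∀ {A B E : C} (f g : A ⟶ B ⊗ E), pureMorphisms f → pureMorphisms g →
    f ≫ B ◁ discard E ≫ (ρ_ B).hom = g ≫ B ◁ discard E ≫ (ρ_ B).hom →
    ∃ U : E ⟶ E, pureMorphisms U ∧ IsUnitary U ∧ g = f ≫ B ◁ U

/-- For every dagger kernel `k`, the effects `discard ∘ k†` and `discard ∘ (k^⊥)†` are total. -/
def CausallyComplemented : Prop :=
  ∀ (K L A : C) (k : K ⟶ A) (l : L ⟶ A), IsKernel k → IsComplement k l →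
    IsTotalPair (dag k ≫ discard K) (dag l ≫ discard L)

/-- Every causal pure state of a non-trivial object is excluded by some non-zero effect. -/
def PureExclusion : Prop :=
  ∀ A : C, ¬ IsTrivialObj A → ∀ s : 𝟙_ C ⟶ A, pureMorphisms s → IsCausal s →
    ∃ e : A ⟶ 𝟙_ C, e ≠ 0 ∧ s ≫ e = 0

/-- All dagger kernels are causal. -/
def KernelsCausal : Prop := ∀ (K A : C) (k : K ⟶ A), IsKernel k → IsCausal k

variable {C}

/-- `discard ∘ k† + discard ∘ (k^⊥)† = discard` for every dagger kernel `k`. -/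
def KernelsSum (S : CoarseGraining C) : Prop :=
  ∀ (K L A : C) (k : K ⟶ A) (l : L ⟶ A), IsKernel k → IsComplement k l →
    S.add (dag k ≫ discard K) (dag l ≫ discard L) = discard A

end DaggerTheory

/-!
Write `d` for discarding and compose from right to left.

*Kernels are causal.* Under strong purification `d ∘ f = 0` forces `f = 0`. Hence a dilation
`h : K ⟶ A ⊗ E` of a kernel `k` of `f` satisfies `(f ⊗ id) ∘ h = 0`; bending the wire `E` shows that
`h` factors through `k ⊗ id`, and the factor dilates the pure morphism `id`, so `h = k ⊗ r`. Thus `k`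
is pure, and as an isometry it is causal (`StrongPurification.kernelsCausal`).

*Complementation and sums.* With a coarse-graining operation and causal kernels, comparing
`k k† + l l†` with `id` by the total pair `d k†`, `d l†` gives `d k† + d l† = d`; conversely this
equation makes the pair total.

*A control system.* A causal pure state is the kernel of its cokernel by pure exclusion. Two such
states, the second in the complement of the first, span an object `Q` on which they are complementary
kernel states `k0`, `k1` (`exists_isBasisPair`). Every coarse-graining operation satisfies
`k0 + k1 = d†` on `Q`, so `f + g` is `f ⊗ k0† + g ⊗ k1†` restricted along `d†`, whichever operation is
used for the sum: there is at most one.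

*Existence.* By conditioning and compactness, any `f, g : A ⟶ B` are the restrictions along `k0` and
`k1` of some `t : A ⊗ Q ⟶ B`, and by causal complementation the restriction of `t` along `d†` depends
on `f` and `g` only. This defines `f + g`. It has unit `0` and is preserved by composition on both
sides, and since restriction is a precomposition, `+` interchanges with any operation that
precomposition preserves. The Eckmann–Hilton argument, for `+` with itself and for `+` with its
conjugate by the dagger, gives associativity, commutativity and `(f + g)† = f† + g†`.
-/

namespace DaggerTheory

open DaggerSymmetricCategory

/-! ### Restricting morphisms along states -/

section Restrict

variable {C : Type u} [Category.{v} C] [MonoidalCategory C]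

/-- The restriction of `h : A ⊗ Q ⟶ B` along a state of `Q`. -/
def restrict {A B Q : C} (k : 𝟙_ C ⟶ Q) (h : A ⊗ Q ⟶ B) : A ⟶ B := (ρ_ A).inv ≫ A ◁ k ≫ h

theorem restrict_comp {A B D Q : C} (k : 𝟙_ C ⟶ Q) (h : A ⊗ Q ⟶ B) (f : B ⟶ D) :
    restrict k (h ≫ f) = restrict k h ≫ f := by
  simp [restrict]

theorem restrict_whiskerRight_comp {A B D Q : C} (k : 𝟙_ C ⟶ Q) (f : D ⟶ A) (h : A ⊗ Q ⟶ B) :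
    restrict k (f ▷ Q ≫ h) = f ≫ restrict k h := by
  simp only [restrict]
  rw [whisker_exchange_assoc, ← rightUnitor_inv_naturality_assoc]

theorem restrict_associator {A B A' B' Q : C} (k : 𝟙_ C ⟶ Q) (f : A ⟶ B) (h : A' ⊗ Q ⟶ B') :
    restrict k ((α_ A A' Q).hom ≫ (f ⊗ₘ h)) = f ⊗ₘ restrict k h := by
  simp only [restrict]
  rw [associator_naturality_right_assoc, tensorHom_def', tensorHom_def', rightUnitor_tensor_inv]
  simp

/-- Restricting a parallel effect multiplies by the scalar it takes on the state. -/
theorem restrict_tensor_effect {A B Q : C} (k : 𝟙_ C ⟶ Q) (f : A ⟶ B) (e : Q ⟶ 𝟙_ C) :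
    restrict k ((f ⊗ₘ e) ≫ (ρ_ B).hom) = (ρ_ A).inv ≫ (f ⊗ₘ (k ≫ e)) ≫ (ρ_ B).hom := by
  simp only [restrict, tensorHom_def', MonoidalCategory.whiskerLeft_comp, Category.assoc]

theorem restrict_tensor_effect_of_eq_id {A B Q : C} {k : 𝟙_ C ⟶ Q} (f : A ⟶ B) {e : Q ⟶ 𝟙_ C}
    (h : k ≫ e = 𝟙 _) : restrict k ((f ⊗ₘ e) ≫ (ρ_ B).hom) = f := by
  rw [restrict_tensor_effect, h, tensorHom_id, rightUnitor_naturality, Iso.inv_hom_id_assoc]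

end Restrict

/-! ### Daggers -/

section Dagger

variable {C : Type u} [Category.{v} C] [MonoidalCategory C] [SymmetricCategory C]
  [DaggerSymmetricCategory C]

theorem dag_injective {A B : C} {f g : A ⟶ B} (h : dag f = dag g) : f = g := by
  rw [← dag_dag f, h, dag_dag]

theorem dag_zero [HasZeroMorphisms C] (A B : C) : dag (0 : A ⟶ B) = 0 := by
  have h := dag_comp (dag (0 : B ⟶ B)) (0 : B ⟶ B)
  rw [dag_dag, comp_zero] at h
  rw [show (0 : A ⟶ B) = (0 : A ⟶ B) ≫ (0 : B ⟶ B) from comp_zero.symm, dag_comp, h, zero_comp]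

theorem dag_eq_zero [HasZeroMorphisms C] {A B : C} {f : A ⟶ B} (h : dag f = 0) : f = 0 :=
  dag_injective (h.trans (dag_zero A B).symm)

/-! ### Bending wires along a dagger dual -/

namespace IsDaggerDual

variable {A A' : C} {cup : 𝟙_ C ⟶ A' ⊗ A}

/-- Bending the input wire of `f` with the cup and straightening it again with the cap
gives back `f`. -/
theorem straighten_input (hA : IsDaggerDual A A' cup) {B : C} (f : A ⟶ B) :
    (ρ_ A).inv ≫ A ◁ (cup ≫ A' ◁ f) ≫ (α_ A A' B).inv ≫
      ((β_ A A').hom ≫ dag cup) ▷ B ≫ (λ_ B).hom = f := by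
  have h : A ◁ (cup ≫ A' ◁ f) ≫ (α_ A A' B).inv ≫ ((β_ A A').hom ≫ dag cup) ▷ B =
      (A ◁ cup ≫ (α_ A A' A).inv ≫ ((β_ A A').hom ≫ dag cup) ▷ A) ≫ 𝟙_ C ◁ f := by
    rw [Category.assoc, Category.assoc, ← whisker_exchange, MonoidalCategory.whiskerLeft_comp,
      Category.assoc, associator_inv_naturality_right_assoc]
  rw [← Category.assoc (A ◁ _), ← Category.assoc (A ◁ _ ≫ _), Category.assoc (A ◁ _), h,
    hA.snake_left]
  simp

/-- Bending an output wire of `h` with the cap and straightening it again with the cup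
gives back `h`. -/
theorem straighten_output (hA : IsDaggerDual A A' cup) {X B : C} (h : X ⟶ B ⊗ A) :
    (ρ_ X).inv ≫ X ◁ cup ≫ (α_ X A' A).inv ≫
      (h ▷ A' ≫ (α_ B A A').hom ≫ B ◁ ((β_ A A').hom ≫ dag cup) ≫ (ρ_ B).hom) ▷ A = h := by
  have key := congrArg (fun t => (ρ_ X).inv ≫ h ▷ 𝟙_ C ≫ (α_ B A (𝟙_ C)).hom ≫ B ◁ t ≫
    B ◁ (λ_ A).hom) hA.snake_left
  calc _ = (ρ_ X).inv ≫ h ▷ 𝟙_ C ≫ (B ⊗ A) ◁ cup ≫ (α_ (B ⊗ A) A' A).inv ≫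
      ((α_ B A A').hom ≫ B ◁ ((β_ A A').hom ≫ dag cup) ≫ (ρ_ B).hom) ▷ A := by
        rw [← whisker_exchange_assoc]; simp
    _ = _ := by
        refine Eq.trans ?_ (key.trans ?_)
        · generalize (β_ A A').hom ≫ dag cup = cap
          monoidal
        · monoidal

end IsDaggerDual

end Dagger

variable {C : Type u} [Category.{v} C] [MonoidalCategory C] [SymmetricCategory C]
  [HasZeroMorphisms C] [DaggerTheory C]

theorem zero_tensorHom {A B A' B' : C} (f : A' ⟶ B') : (0 : A ⟶ B) ⊗ₘ f = 0 := zero_tensor f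

theorem tensorHom_zero {A B A' B' : C} (f : A' ⟶ B') : f ⊗ₘ (0 : A ⟶ B) = 0 := by
  rw [← cancel_mono (β_ B' B).hom, BraidedCategory.braiding_naturality, zero_tensor]
  simp

theorem zero_whiskerRight' {B D : C} (A : C) : (0 : B ⟶ D) ▷ A = 0 := by
  rw [← tensorHom_id, zero_tensorHom]

/-! ### Dagger kernels and their complements -/

theorem IsDaggerKernel.eq_comp_dag {K A B D : C} {k : K ⟶ A} {f : A ⟶ B}
    (hk : IsDaggerKernel k f) {g : D ⟶ A} (hg : g ≫ f = 0) : (g ≫ dag k) ≫ k = g := by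
  obtain ⟨h, rfl⟩ := hk.factor D g hg
  have := hk.isometry
  unfold IsIsometry at this
  simp [reassoc_of% this]

/-- The complement `coker(k)†` is the dagger kernel of `k†`. -/
theorem IsComplement.isDaggerKernel {K L A : C} {k : K ⟶ A} {l : L ⟶ A} (h : IsComplement k l) :
    IsDaggerKernel l (dag k) where
  isometry := by simpa only [dag_dag] using h.isometry
  zero := dag_injective (by rw [dag_comp, dag_dag, h.zero, dag_zero])
  factor D g hg := by
    obtain ⟨x, hx⟩ := h.factor D (dag g) (by
      rw [← dag_dag k, ← dag_comp, hg, dag_zero])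
    exact ⟨dag x, dag_injective (by rw [hx, dag_comp, dag_dag])⟩

theorem IsDaggerKernel.isComplement {K L A : C} {k : K ⟶ A} {l : L ⟶ A}
    (h : IsDaggerKernel l (dag k)) : IsComplement k l where
  isometry := by simpa only [dag_dag] using h.isometry
  zero := dag_injective (by rw [dag_comp, dag_dag, h.zero, dag_zero])
  factor D g hg := by
    obtain ⟨x, hx⟩ := h.factor D (dag g) (by rw [← dag_comp, hg, dag_zero])
    exact ⟨dag x, dag_injective (by rw [hx, dag_comp, dag_dag, dag_dag])⟩

/-! ### Purity and causality of kernels -/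

namespace StrongPurification

/-- Discarding detects zero: a morphism with zero discarding has the same discarding as `0`, so by
essential uniqueness its purification is zero. -/
theorem eq_zero_of_discard (hP : StrongPurification C) {A B : C} {f : A ⟶ B}
    (hf : f ≫ discard B = 0) : f = 0 := by
  obtain ⟨E, g, hg, hgf⟩ := hP.environment.dilation f
  have hlam : pureMorphisms (λ_ (B ⊗ E)).inv := by
    rw [← dag_leftUnitor]
    exact hP.environment.dag_mem _ (hP.environment.leftUnitor_mem _)
  have hd : g ≫ discard (B ⊗ E) = 0 := by
    have : discard (B ⊗ E) = (B ◁ discard E ≫ (ρ_ B).hom) ≫ discard B := by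
      rw [discard_tensor, tensorHom_def', Category.assoc, Category.assoc,
        ← rightUnitor_naturality, unitors_equal]
    rw [this, ← Category.assoc, hgf, hf]
  obtain ⟨U, -, -, hU⟩ := hP.essentially_unique (0 : A ⟶ 𝟙_ C ⊗ (B ⊗ E)) (g ≫ (λ_ (B ⊗ E)).inv)
    (Or.inl rfl) (hP.environment.comp_mem _ _ hg hlam) (by
      rw [zero_comp, Category.assoc, ← leftUnitor_inv_naturality_assoc, ← Category.assoc, hd,
        zero_comp])
  rw [zero_comp] at hU
  have hg0 : g = 0 := by
    rw [← cancel_mono (λ_ (B ⊗ E)).inv, hU, zero_comp]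
  rw [← hgf, hg0, zero_comp]

/-- A dilation of the kernel `k` of `f` is annihilated by `f`, hence factors through `k`, and the
factor is a dilation of the identity. -/
theorem pure_of_isDaggerKernel (hP : StrongPurification C) (hC : CompactTheory C) {K A B : C}
    {k : K ⟶ A} {f : A ⟶ B} (hk : IsDaggerKernel k f) : pureMorphisms k := by
  have iso : k ≫ dag k = 𝟙 K := hk.isometry
  by_cases h0 : 𝟙 K = 0
  · exact Or.inl (by rw [← Category.id_comp k, h0, zero_comp])
  refine Or.inr fun E h hh => ?_
  unfold IsDilation at hh
  have hf : h ≫ f ▷ E = 0 := hP.eq_zero_of_discard (by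
    have : f ▷ E ≫ discard (B ⊗ E) = (A ◁ discard E ≫ (ρ_ A).hom) ≫ f ≫ discard B := by
      rw [discard_tensor, tensorHom_def', Category.assoc, ← whisker_exchange_assoc,
        Category.assoc, ← comp_whiskerRight_assoc, unitors_equal, rightUnitor_naturality]
    rw [Category.assoc, this, ← Category.assoc, hh, reassoc_of% hk.zero, zero_comp])
  obtain ⟨E', cup, hE, -⟩ := hC E
  have hbend : h ≫ (dag k ≫ k) ▷ E = h := by
    rw [← hE.straighten_output h]
    simp only [Category.assoc, ← comp_whiskerRight]
    congr 4
    have := hk.eq_comp_dag (g := h ▷ E' ≫ (α_ A E E').hom ≫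
      A ◁ ((β_ E E').hom ≫ dag cup) ≫ (ρ_ A).hom) (by
        have e : (α_ A E E').hom ≫ A ◁ ((β_ E E').hom ≫ dag cup) ≫ (ρ_ A).hom ≫ f =
            (f ▷ E) ▷ E' ≫ (α_ B E E').hom ≫ B ◁ ((β_ E E').hom ≫ dag cup) ≫ (ρ_ B).hom := by
          rw [← rightUnitor_naturality, whisker_exchange_assoc]
          simp
        rw [Category.assoc, Category.assoc, Category.assoc, e, ← comp_whiskerRight_assoc, hf,
          zero_whiskerRight', zero_comp])
    simpa only [Category.assoc] using this
  have hid := (hP.environment.id_mem K).resolve_left h0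
  obtain ⟨r, hr, e⟩ := hid E (h ≫ dag k ▷ E) (by
    unfold IsDilation
    rw [Category.assoc, ← whisker_exchange_assoc, rightUnitor_naturality, reassoc_of% hh, iso])
  refine ⟨r, hr, ?_⟩
  rw [← hbend, comp_whiskerRight, ← Category.assoc, e, Category.assoc, ← tensorHom_id,
    tensorHom_comp_tensorHom, Category.id_comp, Category.comp_id]

/-- A pure isometry has the same `f† ∘ f` as the identity, hence the same discarding. -/
theorem kernelsCausal (hP : StrongPurification C) (hC : CompactTheory C) : KernelsCausal C := by
  rintro K A k ⟨B, f, hk⟩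
  have h := (hP.environment.cp k (𝟙 K) (hP.pure_of_isDaggerKernel hC hk)
    (hP.environment.id_mem K)).2 (by rw [dag_id, Category.id_comp]; exact hk.isometry)
  rwa [Category.id_comp] at h

theorem isIsometry_of_causal_state (hP : StrongPurification C) {A : C} {s : 𝟙_ C ⟶ A}
    (hs : pureMorphisms s) (hc : IsCausal s) : IsIsometry s := by
  have h := (hP.environment.cp s (𝟙 _) hs (hP.environment.id_mem _)).1 (by
    rw [Category.id_comp]; exact hc)
  rwa [dag_id, Category.id_comp] at h

end StrongPurification

theorem pure_of_comp_isometry {X A B : C} {s : X ⟶ A} {k : A ⟶ B} (hk : IsIsometry k)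
    (h : pureMorphisms (s ≫ k)) : pureMorphisms s := by
  unfold IsIsometry at hk
  rcases h with h | h
  · exact Or.inl (by rw [← Category.comp_id s, ← hk, reassoc_of% h, zero_comp])
  · refine Or.inr fun E g hg => ?_
    unfold IsDilation at hg
    obtain ⟨r, hr, e⟩ := h E (g ≫ k ▷ E) (by
      unfold IsDilation
      rw [Category.assoc, ← whisker_exchange_assoc, rightUnitor_naturality, reassoc_of% hg])
    refine ⟨r, hr, ?_⟩
    have := congrArg (· ≫ dag k ▷ E) e
    simpa only [Category.assoc, ← comp_whiskerRight, hk, id_whiskerRight, Category.comp_id,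
      tensorHom_comp_whiskerRight] using this

/-! ### An object with a complementary pair of kernel states -/

/-- Two causal states of `Q` that are kernels and complements of each other, such as the
computational basis states of a qubit. -/
structure IsBasisPair {Q : C} (k0 k1 : 𝟙_ C ⟶ Q) : Prop where
  orthonormal : Orthonormal k0 k1
  kernel_left : IsDaggerKernel k0 (dag k1)
  kernel_right : IsDaggerKernel k1 (dag k0)
  causal_left : IsCausal k0
  causal_right : IsCausal k1

/-- A causal pure state `s` is the kernel of its cokernel: on the object `ker(coker(s))` no effect
excludes `s`, so this object is trivial by pure exclusion. -/
theorem exists_comp_eq_of_comp_complement (hK : HasDaggerKernels C) (hC : CompactTheory C)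
    (hP : StrongPurification C) (hE : PureExclusion C) {A L D : C} {s : 𝟙_ C ⟶ A} {l : L ⟶ A}
    (hs : pureMorphisms s) (hc : IsCausal s) (hl : IsDaggerKernel l (dag s)) {x : D ⟶ A}
    (hx : x ≫ dag l = 0) : ∃ y, x = y ≫ s := by
  obtain ⟨K, k, hk⟩ := hK _ _ (dag l)
  have kiso : k ≫ dag k = 𝟙 K := hk.isometry
  have hsl : s ≫ dag l = 0 := hl.isComplement.zero
  obtain ⟨t, ht⟩ := hk.factor _ s hsl
  obtain ⟨h, hh⟩ := hk.factor _ x hx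
  have htp : pureMorphisms t := pure_of_comp_isometry hk.isometry (ht ▸ hs)
  have htc : t ≫ discard K = 𝟙 _ := by
    have e : k ≫ discard A = discard K := hP.kernelsCausal hC _ _ k ⟨_, _, hk⟩
    rw [← e, ← Category.assoc, ← ht, ← discard_unit]
    exact hc
  have htriv : IsTrivialObj K := by
    by_contra hn
    obtain ⟨e, he, hte⟩ := hE K hn t htp (by unfold IsCausal; rw [htc, discard_unit])
    apply he
    obtain ⟨y, hy⟩ := hl.factor _ (dag e ≫ k) (by
      have : k ≫ dag s = dag t := by
        rw [ht, dag_comp, reassoc_of% kiso]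
      rw [Category.assoc, this, ← dag_comp, hte, dag_zero])
    apply dag_eq_zero
    have hlk : l ≫ dag k = 0 := dag_eq_zero (by rw [dag_comp, dag_dag, hk.zero])
    rw [← Category.comp_id (dag e), ← kiso, reassoc_of% hy, hlk, comp_zero]
  rcases htriv with hu | hz
  · have e : t = dag (discard K) := by
      rw [← Category.comp_id t, ← hu.1, reassoc_of% htc]
    have hd := hu.1
    refine ⟨h ≫ discard K, ?_⟩
    rw [hh, ht, e, Category.assoc, reassoc_of% hd]
  · exact ⟨0, by rw [hh, hz.eq_of_src k 0, comp_zero, zero_comp]⟩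

/-- A causal pure state of a non-trivial object and a causal pure state of its complement span an
object on which they are complementary. -/
theorem exists_isBasisPair (hK : HasDaggerKernels C) (hN : NontrivialTheory C)
    (hC : CompactTheory C) (hP : StrongPurification C) (hE : PureExclusion C) :
    ∃ (Q : C) (k0 k1 : 𝟙_ C ⟶ Q), IsBasisPair k0 k1 := by
  have hcaus := hP.kernelsCausal hC
  obtain ⟨A, hA⟩ := hN
  obtain ⟨s, hs, hsc⟩ := hP.state A fun h => hA (Or.inr h)
  obtain ⟨e, he, hse⟩ := hE A hA s hs hsc
  obtain ⟨L, l, hl⟩ := hK _ _ (dag s)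
  have hL : ¬ IsZero L := fun hz => he (dag_eq_zero (by
    obtain ⟨y, hy⟩ := hl.factor _ (dag e) (by rw [← dag_comp, hse, dag_zero])
    rw [hy, hz.eq_of_src l 0, comp_zero]))
  obtain ⟨t, ht, htc⟩ := hP.state L hL
  obtain ⟨M, m, hm⟩ := hK _ _ (dag t)
  -- `Q` is the complement of everything orthogonal to both states, that is, their span.
  obtain ⟨Q, q, hq⟩ := hK _ _ (dag (m ≫ l))
  have liso : l ≫ dag l = 𝟙 L := hl.isometry
  have miso : m ≫ dag m = 𝟙 M := hm.isometry
  have qiso : q ≫ dag q = 𝟙 Q := hq.isometry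
  have siso : s ≫ dag s = 𝟙 _ := hP.isIsometry_of_causal_state hs hsc
  have tiso : t ≫ dag t = 𝟙 _ := hP.isIsometry_of_causal_state ht htc
  have hsl : s ≫ dag l = 0 := hl.isComplement.zero
  have htm : t ≫ dag m = 0 := hm.isComplement.zero
  obtain ⟨k0, hk0⟩ := hq.factor _ s (by rw [dag_comp, reassoc_of% hsl, zero_comp])
  obtain ⟨k1, hk1⟩ := hq.factor _ (t ≫ l) (by
    rw [dag_comp, Category.assoc, reassoc_of% liso, htm])
  have i0 : IsIsometry k0 := by
    unfold IsIsometry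
    rw [← siso, hk0, dag_comp, Category.assoc, reassoc_of% qiso]
  have i1 : IsIsometry k1 := by
    have : (t ≫ l) ≫ dag (t ≫ l) = 𝟙 _ := by
      rw [dag_comp, Category.assoc, reassoc_of% liso, tiso]
    unfold IsIsometry
    rw [← this, hk1, dag_comp, Category.assoc, reassoc_of% qiso]
  have h01 : k0 ≫ dag k1 = 0 := by
    have : s ≫ dag (t ≫ l) = 0 := by rw [dag_comp, reassoc_of% hsl, zero_comp]
    rw [← this, hk0, hk1, dag_comp, Category.assoc, reassoc_of% qiso]
  have h10 : k1 ≫ dag k0 = 0 := dag_eq_zero (by rw [dag_comp, dag_dag, h01])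
  have q0 : q ≫ dag s = dag k0 := by rw [hk0, dag_comp, reassoc_of% qiso]
  have q1 : q ≫ dag l ≫ dag t = dag k1 := by
    rw [← dag_comp, hk1, dag_comp, reassoc_of% qiso]
  have qm : q ≫ dag l ≫ dag m = 0 := by rw [← dag_comp, hq.zero]
  have hcq : q ≫ discard A = discard Q := hcaus _ _ q ⟨_, _, hq⟩
  have hcl : l ≫ discard A = discard L := hcaus _ _ l ⟨_, _, hl⟩
  refine ⟨Q, k0, k1, ⟨i0, i1, h01⟩, ⟨i0, h01, fun D g hg => ?_⟩, ⟨i1, h10, fun D g hg => ?_⟩,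
    ?_, ?_⟩
  · obtain ⟨y, hy⟩ := exists_comp_eq_of_comp_complement hK hC hP hE hs hsc hl (x := g ≫ q) (by
      obtain ⟨z, hz⟩ := hm.factor _ (g ≫ q ≫ dag l) (by
        simp only [Category.assoc, q1, hg])
      have : z = 0 := by
        rw [← Category.comp_id z, ← miso, ← reassoc_of% hz, qm, comp_zero]
      rw [Category.assoc, hz, this, zero_comp])
    refine ⟨y, ?_⟩
    rw [← Category.comp_id g, ← qiso, reassoc_of% hy, hk0]
    simp [qiso]
  · obtain ⟨z, hz⟩ := hl.factor _ (g ≫ q) (by rw [Category.assoc, q0, hg])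
    obtain ⟨y, hy⟩ := exists_comp_eq_of_comp_complement hK hC hP hE ht htc hm (x := z) (by
      rw [← Category.comp_id z, ← liso, Category.assoc, Category.assoc, ← reassoc_of% hz, qm,
        comp_zero])
    refine ⟨y, ?_⟩
    rw [← Category.comp_id g, ← qiso, reassoc_of% hz, hy, Category.assoc, reassoc_of% hk1, qiso,
      Category.comp_id]
  · unfold IsCausal
    rw [← hcq, ← Category.assoc, ← hk0]
    exact hsc
  · unfold IsCausal
    rw [← hcq, ← Category.assoc, ← hk1, Category.assoc, hcl]
    exact htc

/-! ### Coarse-graining and causal complementation -/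

namespace CoarseGraining

variable (S : CoarseGraining C)

theorem zero_add {A B : C} (f : A ⟶ B) : S.add 0 f = f := by
  rw [S.add_comm, S.add_zero]

theorem comp_add {A B D : C} (f : A ⟶ B) (g h : B ⟶ D) :
    f ≫ S.add g h = S.add (f ≫ g) (f ≫ h) :=
  dag_injective (by simp only [dag_comp, S.dag_add, S.add_comp])

theorem causallyComplemented (h : KernelsSum S) : CausallyComplemented C := by
  intro K L A k l hk hl B f g h0 h1
  rw [← h K L A k l hk hl, comp_add, comp_add, h0, h1]

/-- The endomorphism `k k† + l l†` and the identity are indistinguishable by the total pair of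
`k` and its complement `l`. -/
theorem kernelsSum (hc : KernelsCausal C) (h : CausallyComplemented C) : KernelsSum S := by
  intro K L A k l hk hl
  have hck : k ≫ discard A = discard K := hc _ _ k hk
  have hcl : l ≫ discard A = discard L := hc _ _ l ⟨_, _, hl.isDaggerKernel⟩
  have hlk : l ≫ dag k = 0 := hl.isDaggerKernel.zero
  have hkl : k ≫ dag l = 0 := hl.zero
  have kiso : k ≫ dag k = 𝟙 K := by
    obtain ⟨B, f, hf⟩ := hk
    exact hf.isometry
  have liso : l ≫ dag l = 𝟙 L := hl.isDaggerKernel.isometry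
  have := h K L A k l hk hl A (S.add (dag k ≫ k) (dag l ≫ l)) (𝟙 A)
    (by simp [S.add_comp, reassoc_of% kiso, reassoc_of% hlk, S.add_zero])
    (by simp [S.add_comp, reassoc_of% liso, reassoc_of% hkl, S.zero_add])
  simpa only [S.add_comp, Category.assoc, hck, hcl, Category.id_comp] using this

theorem conditioning (S : CoarseGraining C) : Conditioning C := by
  rintro A k0 k1 ⟨h0, h1, h01⟩ B s t
  unfold IsIsometry at h0 h1
  have h10 : k1 ≫ dag k0 = 0 := dag_eq_zero (by rw [dag_comp, dag_dag, h01])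
  refine ⟨S.add (dag k0 ≫ s) (dag k1 ≫ t), ?_, ?_⟩
  · simp [comp_add, reassoc_of% h0, reassoc_of% h01, S.add_zero]
  · simp [comp_add, reassoc_of% h1, reassoc_of% h10, S.zero_add]

end CoarseGraining

/-! ### Sums from conditioning and discarding -/

theorem restrict_tensor_effect_of_eq_zero {A B Q : C} {k : 𝟙_ C ⟶ Q} (f : A ⟶ B)
    {e : Q ⟶ 𝟙_ C} (h : k ≫ e = 0) : restrict k ((f ⊗ₘ e) ≫ (ρ_ B).hom) = 0 := by
  rw [restrict_tensor_effect, h, tensorHom_zero, zero_comp, comp_zero]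

namespace IsBasisPair

variable {Q : C} {k0 k1 : 𝟙_ C ⟶ Q}

theorem symm (h : IsBasisPair k0 k1) : IsBasisPair k1 k0 :=
  ⟨⟨h.orthonormal.2.1, h.orthonormal.1, h.kernel_right.zero⟩, h.kernel_right, h.kernel_left,
    h.causal_right, h.causal_left⟩

theorem discard_comp_dag (h : IsBasisPair k0 k1) : dag (discard Q) ≫ dag k0 = 𝟙 _ := by
  rw [← dag_comp, h.causal_left, discard_unit, dag_id]

theorem exists_restrict (h : IsBasisPair k0 k1) (hC : CompactTheory C) (hcond : Conditioning C)
    {A B : C} (f g : A ⟶ B) : ∃ t : A ⊗ Q ⟶ B, restrict k0 t = f ∧ restrict k1 t = g := by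
  obtain ⟨A', cup, hA, -⟩ := hC A
  obtain ⟨t, h0, h1⟩ := hcond Q k0 k1 h.orthonormal _ (cup ≫ A' ◁ f) (cup ≫ A' ◁ g)
  refine ⟨A ◁ t ≫ (α_ A A' B).inv ≫ ((β_ A A').hom ≫ dag cup) ▷ B ≫ (λ_ B).hom, ?_, ?_⟩
  · rw [restrict, ← MonoidalCategory.whiskerLeft_comp_assoc, h0, hA.straighten_input]
  · rw [restrict, ← MonoidalCategory.whiskerLeft_comp_assoc, h1, hA.straighten_input]

/-- By causal complementation, applied to daggers of morphisms `Q ⟶ B`, the restriction along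
`discard†` depends only on the restrictions along the two basis states. -/
theorem restrict_discard_unique (h : IsBasisPair k0 k1) (hC : CompactTheory C)
    (hcc : CausallyComplemented C) {A B : C} {t t' : A ⊗ Q ⟶ B}
    (h0 : restrict k0 t = restrict k0 t') (h1 : restrict k1 t = restrict k1 t') :
    restrict (dag (discard Q)) t = restrict (dag (discard Q)) t' := by
  obtain ⟨A', cup, hA, -⟩ := hC A
  have bend : ∀ (k : 𝟙_ C ⟶ Q) (t : A ⊗ Q ⟶ B),
      k ≫ (λ_ Q).inv ≫ cup ▷ Q ≫ (α_ A' A Q).hom ≫ A' ◁ t = cup ≫ A' ◁ restrict k t := by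
    intro k t
    rw [restrict, leftUnitor_inv_naturality_assoc, whisker_exchange_assoc]
    rw [unitors_inv_equal, ← rightUnitor_inv_naturality_assoc]
    simp
  have hs := hcc _ _ _ k0 k1 ⟨_, _, h.kernel_left⟩ h.kernel_right.isComplement _
    (dag ((λ_ Q).inv ≫ cup ▷ Q ≫ (α_ A' A Q).hom ≫ A' ◁ t))
    (dag ((λ_ Q).inv ≫ cup ▷ Q ≫ (α_ A' A Q).hom ≫ A' ◁ t'))
    (by rw [← Category.assoc (dag _) (dag k0), ← dag_comp, bend, h0, ← bend, dag_comp k0,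
      Category.assoc])
    (by rw [← Category.assoc (dag _) (dag k1), ← dag_comp, bend, h1, ← bend, dag_comp k1,
      Category.assoc])
  have hs' := congrArg dag hs
  rw [dag_comp _ (discard Q), dag_comp _ (discard Q), dag_dag, dag_dag, bend, bend] at hs'
  rw [← hA.straighten_input (restrict (dag (discard Q)) t), hs', hA.straighten_input]

/-- Any coarse-graining operation sums `f` and `g` by discarding the control system of
`f ⊗ k0† + g ⊗ k1†`, because `discard† = k0 + k1`. -/
theorem coarseGraining_unique (h : IsBasisPair k0 k1) (hc : KernelsCausal C)
    (hcc : CausallyComplemented C) (S T : CoarseGraining C) : S = T := by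
  have hd : ∀ R : CoarseGraining C, R.add k0 k1 = dag (discard Q) := fun R => by
    have := R.kernelsSum hc hcc _ _ _ k0 k1 ⟨_, _, h.kernel_left⟩ h.kernel_right.isComplement
    apply dag_injective
    rw [dag_dag, ← this, R.dag_add, discard_unit, Category.comp_id, Category.comp_id]
  have hr : ∀ (R : CoarseGraining C) {A B : C} (t : A ⊗ Q ⟶ B),
      restrict (dag (discard Q)) t = R.add (restrict k0 t) (restrict k1 t) := fun R A B t => by
    simp only [restrict, ← hd R, ← id_tensorHom, R.tensor_add, R.add_comp, R.comp_add]
  have i0 := h.orthonormal.1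
  have i1 := h.orthonormal.2.1
  have h01 := h.orthonormal.2.2
  have h10 := h.kernel_right.zero
  ext A B f g
  have e0 : restrict k0 (S.add ((f ⊗ₘ dag k0) ≫ (ρ_ B).hom) ((g ⊗ₘ dag k1) ≫ (ρ_ B).hom)) = f := by
    have := restrict_tensor_effect_of_eq_id f i0
    have h' := restrict_tensor_effect_of_eq_zero g h01
    simp only [restrict] at this h' ⊢
    rw [S.comp_add, S.comp_add, this, h', S.add_zero]
  have e1 : restrict k1 (S.add ((f ⊗ₘ dag k0) ≫ (ρ_ B).hom) ((g ⊗ₘ dag k1) ≫ (ρ_ B).hom)) = g := by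
    have := restrict_tensor_effect_of_eq_zero f h10
    have h' := restrict_tensor_effect_of_eq_id g i1
    simp only [restrict] at this h' ⊢
    rw [S.comp_add, S.comp_add, this, h', S.zero_add]
  have hS := hr S (S.add ((f ⊗ₘ dag k0) ≫ (ρ_ B).hom) ((g ⊗ₘ dag k1) ≫ (ρ_ B).hom))
  have hT := hr T (S.add ((f ⊗ₘ dag k0) ≫ (ρ_ B).hom) ((g ⊗ₘ dag k1) ≫ (ρ_ B).hom))
  rw [e0, e1] at hS hT
  exact hS.symm.trans hT

/-- The sum of `f` and `g` is obtained from a morphism `A ⊗ Q ⟶ B` restricting to `f` and `g` on the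
basis states, by restricting it along `discard†`. -/
theorem nonempty_coarseGraining (h : IsBasisPair k0 k1) (hC : CompactTheory C)
    (hcond : Conditioning C) (hcc : CausallyComplemented C) : Nonempty (CoarseGraining C) := by
  choose ctrl hctrl0 hctrl1 using
    fun (A B : C) (f g : A ⟶ B) => h.exists_restrict hC hcond f g
  let add : ∀ {A B : C}, (A ⟶ B) → (A ⟶ B) → (A ⟶ B) := fun {A B} f g =>
    restrict (dag (discard Q)) (ctrl A B f g)
  have add_eq : ∀ {A B : C} {f g : A ⟶ B} (t : A ⊗ Q ⟶ B), restrict k0 t = f →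
      restrict k1 t = g → add f g = restrict (dag (discard Q)) t := fun t h0 h1 =>
    h.restrict_discard_unique hC hcc ((hctrl0 _ _ _ _).trans h0.symm)
      ((hctrl1 _ _ _ _).trans h1.symm)
  have add_zero : ∀ {A B : C} (f : A ⟶ B), add f 0 = f := fun {A B} f => by
    rw [add_eq ((f ⊗ₘ dag k0) ≫ (ρ_ B).hom)
      (restrict_tensor_effect_of_eq_id f h.orthonormal.1)
      (restrict_tensor_effect_of_eq_zero f h.kernel_right.zero),
      restrict_tensor_effect_of_eq_id f h.discard_comp_dag]
  have zero_add : ∀ {A B : C} (f : A ⟶ B), add 0 f = f := fun {A B} f => by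
    rw [add_eq ((f ⊗ₘ dag k1) ≫ (ρ_ B).hom)
      (restrict_tensor_effect_of_eq_zero f h.kernel_left.zero)
      (restrict_tensor_effect_of_eq_id f h.orthonormal.2.1),
      restrict_tensor_effect_of_eq_id f h.symm.discard_comp_dag]
  have add_comp : ∀ {A B D : C} (g g' : A ⟶ B) (f : B ⟶ D),
      add g g' ≫ f = add (g ≫ f) (g' ≫ f) := fun {A B D} g g' f => by
    rw [add_eq (ctrl A B g g' ≫ f) (by rw [restrict_comp, hctrl0])
      (by rw [restrict_comp, hctrl1]), restrict_comp]
  have comp_add : ∀ {A B D : C} (f : A ⟶ B) (g g' : B ⟶ D),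
      f ≫ add g g' = add (f ≫ g) (f ≫ g') := fun {A B D} f g g' => by
    rw [add_eq (f ▷ Q ≫ ctrl B D g g') (by rw [restrict_whiskerRight_comp, hctrl0])
      (by rw [restrict_whiskerRight_comp, hctrl1]), restrict_whiskerRight_comp]
  -- Restriction is precomposition, so `add` interchanges with every operation that
  -- precomposition preserves.
  have interchange : ∀ (op : ∀ {A B : C}, (A ⟶ B) → (A ⟶ B) → (A ⟶ B)),
      (∀ {A B D : C} (f : A ⟶ B) (g g' : B ⟶ D), f ≫ op g g' = op (f ≫ g) (f ≫ g')) →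
      ∀ {A B : C} (a b c d : A ⟶ B), op (add a b) (add c d) = add (op a c) (op b d) := by
    intro op hop A B a b c d
    have hr : ∀ k : 𝟙_ C ⟶ Q, restrict k (op (ctrl A B a b) (ctrl A B c d)) =
        op (restrict k (ctrl A B a b)) (restrict k (ctrl A B c d)) := fun k => by
      simp only [restrict, hop]
    exact (hr _).symm.trans (add_eq (f := op a c) (g := op b d) _
      ((hr k0).trans (by rw [hctrl0, hctrl0])) ((hr k1).trans (by rw [hctrl1, hctrl1]))).symm
  have unital : ∀ A B : C, EckmannHilton.IsUnital (add (A := A) (B := B)) 0 := fun A B =>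
    { left_id := zero_add, right_id := add_zero }
  have unital' : ∀ A B : C,
      EckmannHilton.IsUnital (fun f g : A ⟶ B => dag (add (dag f) (dag g))) 0 := fun A B =>
    { left_id := fun f => by rw [dag_zero, zero_add, dag_dag]
      right_id := fun f => by rw [dag_zero, add_zero, dag_dag] }
  exact ⟨
    { add := add
      add_assoc := fun {A B} f g k =>
        (EckmannHilton.mul_assoc (unital A B) (unital A B) (interchange add comp_add)).assoc f g k
      add_comm := fun {A B} f g =>
        (EckmannHilton.mul_comm (unital A B) (unital A B) (interchange add comp_add)).comm f g
      add_zero := add_zero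
      add_comp := add_comp
      tensor_add := fun {A B A' B'} f g g' => by
        rw [add_eq ((α_ A A' Q).hom ≫ (f ⊗ₘ ctrl A' B' g g'))
          (by rw [restrict_associator, hctrl0]) (by rw [restrict_associator, hctrl1]),
          restrict_associator]
      dag_add := fun {A B} f g => by
        -- The conjugate of `add` by the dagger is preserved by precomposition as well, so it
        -- agrees with `add`.
        have := EckmannHilton.mul (unital' A B) (unital A B)
          (interchange (fun f g => dag (add (dag f) (dag g))) fun f g g' => dag_injective (by
            simp only [dag_comp, dag_dag, add_comp]))
        rw [← congrFun (congrFun this f) g, dag_dag] }⟩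

end IsBasisPair

end DaggerTheory

theorem proposition5 (C : Type u) [Category.{v} C] [MonoidalCategory C] [SymmetricCategory C]
    [HasZeroMorphisms C] [DaggerTheory C] (hK : DaggerTheory.HasDaggerKernels C) :
    (DaggerTheory.NontrivialTheory C → DaggerTheory.CompactTheory C → DaggerTheory.StrongPurification C →
      DaggerTheory.CausallyComplemented C → DaggerTheory.PureExclusion C →
        (DaggerTheory.Conditioning C ↔ Nonempty (DaggerTheory.CoarseGraining C)) ∧
        (∀ S T : DaggerTheory.CoarseGraining C, S = T)) ∧
    (∀ S : DaggerTheory.CoarseGraining C,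
      (DaggerTheory.CompactTheory C → DaggerTheory.StrongPurification C →
        (DaggerTheory.CausallyComplemented C ↔
          DaggerTheory.KernelsCausal C ∧ DaggerTheory.KernelsSum S)) ∧
      (DaggerTheory.KernelsCausal C ∧ DaggerTheory.CausallyComplemented C ↔
        DaggerTheory.KernelsCausal C ∧ DaggerTheory.KernelsSum S)) := by
  refine ⟨fun hN hC hP hcc hE => ?_, fun S => ⟨fun hC hP => ?_, ?_⟩⟩
  · obtain ⟨Q, k0, k1, hQ⟩ := DaggerTheory.exists_isBasisPair hK hN hC hP hE
    exact ⟨⟨fun h => hQ.nonempty_coarseGraining hC h hcc, fun ⟨S⟩ => S.conditioning⟩,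
      hQ.coarseGraining_unique (hP.kernelsCausal hC) hcc⟩
  · have hc := hP.kernelsCausal hC
    exact ⟨fun h => ⟨hc, S.kernelsSum hc h⟩, fun h => S.causallyComplemented h.2⟩
  · exact ⟨fun h => ⟨h.1, S.kernelsSum h.1 h.2⟩, fun h => ⟨h.1, S.causallyComplemented h.2⟩⟩
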